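/- Let $\mathfrak A$ be a unital $C^*$-algebra with unit $\mathbf 1$, let $\mathcal S(\mathfrak A)$ be its set of states (positive linear functionals of norm $1$), and let $A\in\mathfrak A$ be a positive element. Put $$\mathcal S_A(\mathfrak A)=\Big\{\tfrac{f}{f(A)}: f\in\mathcal S(\mathfrak A),\ f(A)\neq 0\Big\},\qquad \|X\|_A=\sup\Big\{\sqrt{f(X^*AX)}: f\in\mathcal S_A(\mathfrak A)\Big\}\in[0,\infty]$$ for $X\in\mathfrak A$ (with $\sup\emptyset=0$), and $\mathfrak A^A=\{X\in\mathfrak A:\|X\|_A<\infty\}$. For $X\in\mathfrak A^A$ define the right and left $A$-spectra $$\sigma_A^r(X)=\{\lambda\in\mathbb C:\ \text{there is no } Y\in\mathfrak A^A \text{ with } A(\lambda\mathbf 1-X)Y=A\},$$ $$\sigma_A^l(X)=\{\lambda\in\mathbb C:\ \text{there is no } Y\in\mathfrak A^A \text{ with } AY(\lambda\mathbf 1-X)=A\}.$$ Suppose that $A$ is well-supported, i.e. that $\sigma(A^*A)\setminus\{0\}$ is closed. Then for every $X\in\mathfrak A^A$, $$\sigma_A^r(X)=\big\{f(AX): f\in\mathcal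 S_A(\mathfrak A)\text{ and } f(AXY)=f(AX)f(AY)\ \text{ for all } Y\in\mathfrak A^A\big\}$$ and $$\sigma_A^l(X)=\big\{f(AX): f\in\mathcal S_A(\mathfrak A)\text{ and } f(AYX)=f(AX)f(AY)\ \text{ for all } Y\in\mathfrak A^A\big\}.$$ Moreover (the case $A=\mathbf 1$), for every $X\in\mathfrak A$ the usual spectrum is $$\sigma(X)=\big\{f(X): f\in\mathcal S(\mathfrak A)\text{ such that } f(XY)=f(X)f(Y)\ \text{ for all } Y\in\mathfrak A,\ \text{ or }\ f(YX)=f(X)f(Y)\ \text{ for all } Y\in\mathfrak A\big\}.$$ -/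

import Mathlib

open scoped ComplexOrder ENNReal

namespace ASpectrum

section Definitions

variable {𝔄 : Type*} [CStarAlgebra 𝔄] [PartialOrder 𝔄] [StarOrderedRing 𝔄]

/-- The states of `𝔄`: the positive bounded linear functionals of norm `1`. -/
def states (𝔄 : Type*) [CStarAlgebra 𝔄] [PartialOrder 𝔄] [StarOrderedRing 𝔄] :
    Set (𝔄 →L[ℂ] ℂ) :=
  {f | (∀ X : 𝔄, 0 ≤ X → 0 ≤ f X) ∧ ‖f‖ = 1}

/-- The set `𝒮_A(𝔄)` of all `f / f(A)`, where `f` is a state with `f(A) ≠ 0`. -/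
def aStates (A : 𝔄) : Set (𝔄 →L[ℂ] ℂ) :=
  {g | ∃ f ∈ states 𝔄, f A ≠ 0 ∧ g = (f A)⁻¹ • f}

/-- The `A`-operator semi-norm `‖X‖_A`, the supremum of `√(f(X* A X))` over `f ∈ 𝒮_A(𝔄)`,
with values in `[0, ∞]`. For `A ≥ 0` the numbers `f(X* A X)` are real and non-negative. -/
noncomputable def aNorm (A X : 𝔄) : ℝ≥0∞ :=
  ⨆ f ∈ aStates A, ENNReal.ofReal (Real.sqrt (f (star X * A * X)).re)

/-- The set `𝔄^A` of all elements of finite `A`-operator semi-norm. -/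
def aFinite (A : 𝔄) : Set 𝔄 :=
  {X | aNorm A X < ∞}

/-- `X` is well-supported if `σ(X* X) \ {0}` is closed. -/
def WellSupported (X : 𝔄) : Prop :=
  IsClosed (spectrum ℂ (star X * X) \ {0})

/-- `X` is `A`-left invertible in `𝔄^A`. -/
def IsALeftInvertible (A X : 𝔄) : Prop :=
  ∃ Y ∈ aFinite A, A * Y * X = A

/-- `X` is `A`-right invertible in `𝔄^A`. -/
def IsARightInvertible (A X : 𝔄) : Prop :=
  ∃ Y ∈ aFinite A, A * X * Y = A

/-- The left `A`-spectrum of `X`. -/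
def leftASpectrum (A X : 𝔄) : Set ℂ :=
  {z | ¬ IsALeftInvertible A (z • (1 : 𝔄) - X)}

/-- The right `A`-spectrum of `X`. -/
def rightASpectrum (A X : 𝔄) : Set ℂ :=
  {z | ¬ IsARightInvertible A (z • (1 : 𝔄) - X)}

end Definitions

end ASpectrum

/-!
The engine is a Hahn-Banach argument (`exists_state_apply_eq_zero`): a positive element `D` that is
not invertible is annihilated by a state `f`. By the Cauchy-Schwarz inequality, `f(S S*) = 0` then
makes `f` vanish on the right ideal `S𝔄`, and `f(S* S) = 0` makes it vanish on the left ideal `𝔄S`.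

For the usual spectrum: if `T = z - X` is not invertible, then `T T*` or `T* T` is not, and a state
that annihilates it satisfies `f(XY) = z f(Y)` for all `Y`, or `f(YX) = z f(Y)` for all `Y`; `Y = 1`
gives `z = f(X)`. Conversely, a state with one of the multiplicativity properties vanishes on the
ideal generated on one side by `f(X) - X`, which therefore does not contain `1`.

For the `A`-spectra, well-supportedness provides the support projection `P` of `A` inside `𝔄`, with
`A P = P A = A`, together with some `B` such that `B A² = P` (`WellSupported.exists_support`). Put
`S = A(z - X)`. If `S S* + (1 - P)` has an inverse `E`, then `S S* E = P`, and `Y = S* E A` is an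
`A`-right inverse of `z - X`; it lies in `𝔄^A`, as all of `𝔄A` does (`mul_mem_aFinite`). Otherwise
some state annihilates both `S S*` and `1 - P`, and then it does not vanish at `A`, so that
normalizing it yields the desired functional. The left `A`-spectrum is treated in the same way with
`S* S + (1 - P)`, but there one needs in addition that elements `Y` of `𝔄^A` satisfy `A Y P = A Y`
(`mul_mul_eq_zero_of_mem_aFinite`), so that `A Y (z - X) = A Y B A S` lies in `𝔄S`.
-/

namespace ASpectrum

/-! ### States annihilating non-invertible positive elements -/

/-- The standard trick: `f X = α + iβ` has `(β + t)² ≤ ‖X + it‖² ≤ ‖X‖² + t²` for all real `t`. -/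
lemma im_eq_zero_of_norm_le_one {𝔄 : Type*} [CStarAlgebra 𝔄] {f : 𝔄 →L[ℂ] ℂ} (hf : ‖f‖ ≤ 1)
    (hf1 : f 1 = 1) {X : 𝔄} (hX : IsSelfAdjoint X) : (f X).im = 0 := by
  have key : ∀ t : ℝ, ((f X).im + t) ^ 2 ≤ ‖X‖ ^ 2 + t ^ 2 * ‖(1 : 𝔄)‖ := by
    intro t
    set Z : 𝔄 := X + (Complex.I * t) • (1 : 𝔄) with hZ
    have h1 : (f Z).im = (f X).im + t := by simp [hZ, hf1]
    have h2 : star Z * Z = X * X + ((t : ℂ) ^ 2) • (1 : 𝔄) := by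
      have hc : star (Complex.I * (t : ℂ)) = -(Complex.I * t) := by simp
      rw [hZ, star_add, star_smul, star_one, hX.star_eq, hc]
      simp only [add_mul, mul_add, smul_mul_assoc, mul_smul_comm, one_mul, mul_one, neg_smul,
        neg_mul, smul_add, smul_neg]
      have : -(Complex.I * (t : ℂ) * (Complex.I * t)) = (t : ℂ) ^ 2 := by
        linear_combination -(t : ℂ) ^ 2 * Complex.I_sq
      rw [← this, neg_smul, ← smul_smul (Complex.I * (t : ℂ)) (Complex.I * t)]
      abel
    calc ((f X).im + t) ^ 2 = |(f Z).im| ^ 2 := by rw [sq_abs, h1]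
      _ ≤ ‖f Z‖ ^ 2 := by gcongr; exact Complex.abs_im_le_norm _
      _ ≤ ‖Z‖ ^ 2 := by
        gcongr
        calc ‖f Z‖ ≤ ‖f‖ * ‖Z‖ := f.le_opNorm Z
          _ ≤ 1 * ‖Z‖ := by gcongr
          _ = ‖Z‖ := one_mul _
      _ = ‖X * X + ((t : ℂ) ^ 2) • (1 : 𝔄)‖ := by rw [← h2, CStarRing.norm_star_mul_self, sq]
      _ ≤ ‖X * X‖ + ‖((t : ℂ) ^ 2) • (1 : 𝔄)‖ := norm_add_le _ _
      _ ≤ ‖X‖ ^ 2 + t ^ 2 * ‖(1 : 𝔄)‖ := by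
        rw [sq ‖X‖]
        gcongr
        · exact norm_mul_le _ _
        · rw [norm_smul]; simp
  have h1 : ‖(1 : 𝔄)‖ ≤ 1 := by
    rcases subsingleton_or_nontrivial 𝔄 with _ | _
    · rw [Subsingleton.elim (1 : 𝔄) 0]; simp
    · rw [CStarRing.norm_one]
  by_contra hβ
  set β := (f X).im
  -- This `t` makes `2βt = ‖X‖² + 1`, which exceeds the bound `‖X‖² - β²`.
  have h := key ((‖X‖ ^ 2 + 1) / (2 * β))
  have h3 : ((‖X‖ ^ 2 + 1) / (2 * β)) ^ 2 * ‖(1 : 𝔄)‖ ≤ ((‖X‖ ^ 2 + 1) / (2 * β)) ^ 2 * 1 := by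
    gcongr
  have h4 : β * ((‖X‖ ^ 2 + 1) / (2 * β)) = (‖X‖ ^ 2 + 1) / 2 := by field_simp
  nlinarith [sq_nonneg β]

variable {𝔄 : Type*} [CStarAlgebra 𝔄] [PartialOrder 𝔄] [StarOrderedRing 𝔄]

/-- A functional of norm one that attains its norm at the unit is positive. -/
lemma mem_states_of_norm_eq_one {f : 𝔄 →L[ℂ] ℂ} (hf : ‖f‖ = 1) (hf1 : f 1 = 1) :
    f ∈ states 𝔄 := by
  refine ⟨fun X hX => ?_, hf⟩
  have him : (f X).im = 0 := im_eq_zero_of_norm_le_one hf.le hf1 (.of_nonneg hX)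
  have hle : ‖algebraMap ℝ 𝔄 ‖X‖ - X‖ ≤ ‖X‖ := by
    refine ((CStarAlgebra.mem_Icc_algebraMap_iff_norm_le (norm_nonneg X)).1 ⟨?_, ?_⟩).2
    · exact sub_nonneg.2 (IsSelfAdjoint.of_nonneg hX).le_algebraMap_norm_self
    · exact sub_le_self _ hX
  have hfa : f (algebraMap ℝ 𝔄 ‖X‖) = (‖X‖ : ℂ) := by
    rw [IsScalarTower.algebraMap_apply ℝ ℂ 𝔄, Algebra.algebraMap_eq_smul_one, map_smul, hf1]
    simp
  have h : ‖X‖ - (f X).re ≤ ‖X‖ := by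
    calc ‖X‖ - (f X).re = (f (algebraMap ℝ 𝔄 ‖X‖ - X)).re := by rw [map_sub, hfa]; simp
      _ ≤ ‖f (algebraMap ℝ 𝔄 ‖X‖ - X)‖ := Complex.re_le_norm _
      _ ≤ ‖f‖ * ‖algebraMap ℝ 𝔄 ‖X‖ - X‖ := f.le_opNorm _
      _ ≤ ‖X‖ := by rw [hf, one_mul]; exact hle
  exact Complex.nonneg_iff.2 ⟨by linarith, him.symm⟩

/-- A positive element `D` that is not invertible is annihilated by some state: for `c > ‖D‖` the
norm of `2c - D` is `2c`, and a norming functional of `2c - D` must take the value `c` at both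
`c` and `c - D`. -/
lemma exists_state_apply_eq_zero {D : 𝔄} (hD : 0 ≤ D) (hu : ¬ IsUnit D) :
    ∃ f ∈ states 𝔄, f 1 = 1 ∧ f D = 0 := by
  have : Nontrivial 𝔄 := by
    by_contra h
    rw [not_nontrivial_iff_subsingleton] at h
    exact hu (isUnit_of_subsingleton D)
  set c : ℝ := ‖D‖ + 1 with hc
  have hc0 : 0 < c := by positivity
  have hU : ‖algebraMap ℝ 𝔄 c - D‖ ≤ c := by
    refine ((CStarAlgebra.mem_Icc_algebraMap_iff_norm_le hc0.le).1 ⟨?_, sub_le_self _ hD⟩).2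
    refine sub_nonneg.2 ((IsSelfAdjoint.of_nonneg hD).le_algebraMap_norm_self.trans ?_)
    rw [hc, map_add, map_one]
    exact le_add_of_nonneg_right zero_le_one
  have hspec : 2 * c ≤ ‖algebraMap ℝ 𝔄 (2 * c) - D‖ := by
    have h0 : 2 * c ∈ spectrum ℝ (algebraMap ℝ 𝔄 (2 * c) - D) := by
      rw [spectrum.mem_iff]
      simpa using hu
    calc 2 * c ≤ ‖2 * c‖ := Real.le_norm_self _
      _ ≤ _ := spectrum.norm_le_norm_of_mem h0
  obtain ⟨f, hf, hfx⟩ := exists_dual_vector' ℂ (algebraMap ℝ 𝔄 (2 * c) - D)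
  have hadd : algebraMap ℝ 𝔄 (2 * c) - D = algebraMap ℝ 𝔄 c + (algebraMap ℝ 𝔄 c - D) := by
    rw [two_mul, map_add]; abel
  have hfa : f (algebraMap ℝ 𝔄 c) = (c : ℂ) * f 1 := by
    rw [IsScalarTower.algebraMap_apply ℝ ℂ 𝔄, Algebra.algebraMap_eq_smul_one, map_smul]
    simp
  have hn1 : ‖f 1‖ ≤ 1 := by simpa [hf] using f.le_opNorm 1
  have hnU : ‖f (algebraMap ℝ 𝔄 c - D)‖ ≤ c := by
    refine (f.le_opNorm _).trans ?_
    rwa [hf, one_mul]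
  -- Both terms are at most `c`, so both are equal to `c`.
  have hre : 2 * c ≤ c * (f 1).re + (f (algebraMap ℝ 𝔄 c - D)).re := by
    have := congrArg Complex.re hfx
    rw [hadd, map_add, hfa, ← hadd] at this
    simp only [Complex.add_re, Complex.re_ofReal_mul] at this
    rw [this]
    simpa using hspec
  have hr1 := (Complex.re_le_norm (f 1)).trans hn1
  have hrU := (Complex.re_le_norm _).trans hnU
  have hre1 : (f 1).re = 1 := by nlinarith
  have hf1 : f 1 = 1 := by
    have h := Complex.sq_norm (f 1)
    rw [Complex.normSq_apply, hre1] at h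
    refine Complex.ext hre1 ?_
    have : (f 1).im ^ 2 ≤ 0 := by nlinarith [norm_nonneg (f 1)]
    simpa using pow_eq_zero_iff (two_ne_zero) |>.1 (le_antisymm this (sq_nonneg _))
  have hst := mem_states_of_norm_eq_one hf hf1
  refine ⟨f, hst, hf1, ?_⟩
  have hpos := Complex.nonneg_iff.1 (hst.1 D hD)
  have hsub : (f (algebraMap ℝ 𝔄 c - D)).re = c - (f D).re := by
    rw [map_sub, hfa, hf1]; simp
  refine Complex.ext (le_antisymm ?_ hpos.1) hpos.2.symm
  rw [hre1, mul_one] at hre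
  rw [Complex.zero_re]
  linarith

/-! ### Left and right kernels of positive functionals -/

/-- A positive functional on `𝔄`, as a bundled positive linear map. -/
noncomputable def toPositive (f : 𝔄 →L[ℂ] ℂ) (hf : ∀ X : 𝔄, 0 ≤ X → 0 ≤ f X) : 𝔄 →ₚ[ℂ] ℂ :=
  PositiveLinearMap.mk₀ f.toLinearMap hf

/-- The Cauchy-Schwarz inequality for a positive functional, in the degenerate case. -/
lemma apply_mul_eq_zero_left {f : 𝔄 →L[ℂ] ℂ} (hf : ∀ X : 𝔄, 0 ≤ X → 0 ≤ f X) {S : 𝔄}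
    (hS : f (star S * S) = 0) (Y : 𝔄) : f (Y * S) = 0 := by
  set g := toPositive f hf
  have hgS : ‖g.toPreGNS S‖ = 0 := by
    rw [PositiveLinearMap.preGNS_norm_def]
    change √(f (star S * S)).re = 0
    simp [hS]
  have h := norm_inner_le_norm (𝕜 := ℂ) (g.toPreGNS (star Y)) (g.toPreGNS S)
  rw [hgS, mul_zero, PositiveLinearMap.preGNS_inner_def] at h
  change ‖f (star (star Y) * S)‖ ≤ 0 at h
  simpa using h

lemma apply_mul_eq_zero_right {f : 𝔄 →L[ℂ] ℂ} (hf : ∀ X : 𝔄, 0 ≤ X → 0 ≤ f X) {S : 𝔄}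
    (hS : f (S * star S) = 0) (Y : 𝔄) : f (S * Y) = 0 := by
  set g := toPositive f hf
  have hgS : ‖g.toPreGNS (star S)‖ = 0 := by
    rw [PositiveLinearMap.preGNS_norm_def]
    change √(f (star (star S) * star S)).re = 0
    simp [hS]
  have h := norm_inner_le_norm (𝕜 := ℂ) (g.toPreGNS (star S)) (g.toPreGNS Y)
  rw [hgS, zero_mul, PositiveLinearMap.preGNS_inner_def] at h
  change ‖f (star (star S) * Y)‖ ≤ 0 at h
  simpa using h

/-- A positive functional that vanishes at `1` vanishes, by the Cauchy-Schwarz inequality. -/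
lemma states_apply_one_ne_zero {f : 𝔄 →L[ℂ] ℂ} (hf : f ∈ states 𝔄) : f 1 ≠ 0 := by
  intro h1
  have : f = 0 := by
    ext Y
    simpa using apply_mul_eq_zero_left hf.1 (S := 1) (by simpa using h1) Y
  simpa [this] using hf.2

/-- States detect non-zero positive elements: a state annihilating `‖N‖ - N` takes the value `‖N‖`
at `N`. -/
lemma eq_zero_of_forall_states {N : 𝔄} (hN : 0 ≤ N) (h : ∀ f ∈ states 𝔄, f N = 0) : N = 0 := by
  rcases subsingleton_or_nontrivial 𝔄 with _ | _
  · exact Subsingleton.elim _ _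
  have hu : ¬ IsUnit (algebraMap ℝ 𝔄 ‖N‖ - N) :=
    CStarAlgebra.norm_mem_spectrum_of_nonneg hN
  obtain ⟨f, hf, hf1, hfN⟩ := exists_state_apply_eq_zero
    (sub_nonneg.2 (IsSelfAdjoint.of_nonneg hN).le_algebraMap_norm_self) hu
  rw [map_sub, h f hf, IsScalarTower.algebraMap_apply ℝ ℂ 𝔄, Algebra.algebraMap_eq_smul_one,
    map_smul, hf1] at hfN
  simpa using hfN

/-! ### The spectrum -/

/-- The spectrum of `X` in terms of states: if `X - z` is not invertible, then one of
`(z - X)(z - X)*` and `(z - X)*(z - X)` is not, and is thus annihilated by a state. -/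
lemma spectrum_eq_states (X : 𝔄) :
    spectrum ℂ X =
      {z : ℂ | ∃ f ∈ states 𝔄,
        ((∀ Y : 𝔄, f (X * Y) = f X * f Y) ∨ (∀ Y : 𝔄, f (Y * X) = f X * f Y)) ∧ z = f X} := by
  ext z
  constructor
  · intro hz
    rw [spectrum.mem_iff, Algebra.algebraMap_eq_smul_one] at hz
    set T : 𝔄 := z • (1 : 𝔄) - X with hT
    by_cases hu : IsUnit (T * star T)
    · have hu' : ¬ IsUnit (star T * T) := by
        intro hu'
        obtain ⟨u, hu⟩ := hu
        obtain ⟨v, hv⟩ := hu'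
        refine hz (isUnit_iff_exists_and_exists.2 ⟨⟨star T * ↑u⁻¹, ?_⟩, ⟨↑v⁻¹ * star T, ?_⟩⟩)
        · rw [← mul_assoc, ← hu, Units.mul_inv]
        · rw [mul_assoc, ← hv, Units.inv_mul]
      obtain ⟨f, hf, hf1, hf0⟩ := exists_state_apply_eq_zero (star_mul_self_nonneg T) hu'
      have h : ∀ Y, f (Y * X) = z * f Y := fun Y => by
        have := apply_mul_eq_zero_left hf.1 hf0 Y
        rw [hT, mul_sub, map_sub, mul_smul_comm, mul_one, map_smul, smul_eq_mul] at this
        exact (sub_eq_zero.1 this).symm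
      have hX : f X = z := by simpa [hf1] using h 1
      exact ⟨f, hf, Or.inr (by rwa [hX]), hX.symm⟩
    · obtain ⟨f, hf, hf1, hf0⟩ := exists_state_apply_eq_zero (mul_star_self_nonneg T) hu
      have h : ∀ Y, f (X * Y) = z * f Y := fun Y => by
        have := apply_mul_eq_zero_right hf.1 hf0 Y
        rw [hT, sub_mul, map_sub, smul_mul_assoc, one_mul, map_smul, smul_eq_mul] at this
        exact (sub_eq_zero.1 this).symm
      have hX : f X = z := by simpa [hf1] using h 1
      exact ⟨f, hf, Or.inl (by rwa [hX]), hX.symm⟩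
  · rintro ⟨f, hf, hmul, rfl⟩
    rw [spectrum.mem_iff, Algebra.algebraMap_eq_smul_one]
    rintro ⟨u, hu⟩
    refine states_apply_one_ne_zero hf ?_
    rcases hmul with h | h
    · rw [← u.mul_inv, hu, sub_mul, map_sub, h]; simp
    · rw [← u.inv_mul, hu, mul_sub, map_sub, h]; simp

/-! ### Elements of finite `A`-operator semi-norm -/

lemma re_apply_pos_and_eq {𝔄 : Type*} [CStarAlgebra 𝔄] [PartialOrder 𝔄] {f : 𝔄 →L[ℂ] ℂ}
    (hf : ∀ X : 𝔄, 0 ≤ X → 0 ≤ f X) {A : 𝔄} (hA : 0 ≤ A) (h : f A ≠ 0) :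
    0 < (f A).re ∧ f A = ((f A).re : ℂ) := by
  have h0 := Complex.nonneg_iff.1 (hf A hA)
  have h1 : f A = ((f A).re : ℂ) := Complex.ext rfl h0.2.symm
  refine ⟨h0.1.lt_of_ne fun h2 => h ?_, h1⟩
  rw [h1, ← h2, Complex.ofReal_zero]

/-- Finiteness of `‖X‖_A` bounds `f(X* A X)` by a multiple of `f(A)`, for all positive functionals
`f` with `f(A) ≠ 0` and not only for states. -/
lemma exists_bound_of_mem_aFinite {A X : 𝔄} (hA : 0 ≤ A) (hX : X ∈ aFinite A) :
    ∃ c : ℝ, ∀ f : 𝔄 →L[ℂ] ℂ, (∀ Z : 𝔄, 0 ≤ Z → 0 ≤ f Z) → f A ≠ 0 →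
      (f (star X * A * X)).re ≤ c * (f A).re := by
  refine ⟨(aNorm A X).toReal ^ 2, fun f hf hfA => ?_⟩
  obtain ⟨hpos, hre⟩ := re_apply_pos_and_eq hf hA hfA
  have hnorm : 0 < ‖f‖ := norm_pos_iff.2 fun h => hfA (by simp [h])
  -- The functional `f / f(A)` only depends on `f` up to scaling, so `f` may be taken to be a state.
  have hmem : (f A)⁻¹ • f ∈ aStates A := by
    refine ⟨((‖f‖⁻¹ : ℝ) : ℂ) • f, ⟨fun Z hZ => ?_, ?_⟩, ?_, ?_⟩
    · refine mul_nonneg ?_ (hf Z hZ)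
      exact_mod_cast inv_nonneg.2 hnorm.le
    · rw [norm_smul]; simp [hnorm.ne']
    · simp [hfA, hnorm.ne']
    · rw [smul_smul]
      congr 1
      have : (‖f‖ : ℂ) ≠ 0 := by exact_mod_cast hnorm.ne'
      simp
      field_simp
  have hle : ENNReal.ofReal √(((f A)⁻¹ • f) (star X * A * X)).re ≤ aNorm A X :=
    le_iSup₂_of_le (f := fun (g : 𝔄 →L[ℂ] ℂ) (_ : g ∈ aStates A) =>
      ENNReal.ofReal √(g (star X * A * X)).re) _ hmem le_rfl
  have h2 := (Real.sqrt_le_iff.1 ((ENNReal.ofReal_le_iff_le_toReal (ne_of_lt hX)).1 hle)).2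
  have h3 : (((f A)⁻¹ • f) (star X * A * X)).re = (f A).re⁻¹ * (f (star X * A * X)).re := by
    rw [smul_apply, hre, ← Complex.ofReal_inv, smul_eq_mul,
      Complex.re_ofReal_mul, Complex.ofReal_re]
  rw [h3, inv_mul_le_iff₀ hpos] at h2
  linarith

/-- If `A ≠ 0` and `‖X‖_A` is finite, the bound on `f(X* A X)` persists for `f(A) = 0`: perturb `f`
to `n f + g`, where `g(A) ≠ 0`, and let `n` tend to infinity. -/
lemma apply_conj_eq_zero {A X : 𝔄} (hA : 0 ≤ A) (hX : X ∈ aFinite A) {f : 𝔄 →L[ℂ] ℂ}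
    (hf : ∀ Z : 𝔄, 0 ≤ Z → 0 ≤ f Z) (hfA : f A = 0) : f (star X * A * X) = 0 := by
  -- For `A = 0` there are no functionals in `𝒮_A(𝔄)`, and `hX` carries no information.
  by_cases hA0 : A = 0
  · simp [hA0]
  obtain ⟨g, hg, hgA⟩ : ∃ g ∈ states 𝔄, g A ≠ 0 := by
    by_contra! h
    exact hA0 (eq_zero_of_forall_states hA h)
  obtain ⟨c, hc⟩ := exists_bound_of_mem_aFinite hA hX
  have hN : 0 ≤ star X * A * X := star_left_conjugate_nonneg hA X
  have h0 := Complex.nonneg_iff.1 (hf _ hN)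
  have h1 := Complex.nonneg_iff.1 (hg.1 _ hN)
  refine Complex.ext (le_antisymm (le_of_not_gt fun hlt => ?_) h0.1) h0.2.symm
  rw [Complex.zero_re] at hlt
  obtain ⟨n, hn⟩ := exists_nat_gt (c * (g A).re / (f (star X * A * X)).re)
  rw [div_lt_iff₀ hlt] at hn
  have h := hc ((n : ℂ) • f + g) (fun Z hZ => by
    have : (0 : ℂ) ≤ n := by exact_mod_cast Nat.zero_le n
    exact add_nonneg (mul_nonneg this (hf Z hZ)) (hg.1 Z hZ)) (by simpa [hfA] using hgA)
  simp [hfA] at h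
  linarith

lemma exists_isSelfAdjoint_eq_mul_self {A : 𝔄} (hA : 0 ≤ A) :
    ∃ R : 𝔄, IsSelfAdjoint R ∧ A = R * R :=
  ⟨CFC.sqrt A, .of_nonneg (CFC.sqrt_nonneg A), (CFC.sqrt_mul_sqrt_self A hA).symm⟩

/-- Compression of a functional: `Z ↦ f(E* Z E)`. -/
noncomputable def compress (f : 𝔄 →L[ℂ] ℂ) (E : 𝔄) : 𝔄 →L[ℂ] ℂ :=
  f.comp ((ContinuousLinearMap.mul ℂ 𝔄 (star E)).comp ((ContinuousLinearMap.mul ℂ 𝔄).flip E))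

/-- An element of `𝔄^A` preserves the right kernel of `A`: `Z ↦ f(E* Z E)` vanishes at
`A`, hence at `X* A X`, for every state `f`. -/
lemma mul_mul_eq_zero_of_mem_aFinite {A X E : 𝔄} (hA : 0 ≤ A) (hX : X ∈ aFinite A)
    (hE : A * E = 0) : A * X * E = 0 := by
  have hN : 0 ≤ star X * A * X := star_left_conjugate_nonneg hA X
  have h : star E * (star X * A * X) * E = 0 := by
    refine eq_zero_of_forall_states (star_left_conjugate_nonneg hN E) fun f hf => ?_
    have := apply_conj_eq_zero hA hX (f := compress f E) (fun Z hZ => ?_) ?_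
    · simpa [compress, mul_assoc] using this
    · simpa [compress, mul_assoc] using hf.1 _ (star_left_conjugate_nonneg hZ E)
    · simp [compress, hE]
  obtain ⟨R, hR, rfl⟩ := exists_isSelfAdjoint_eq_mul_self hA
  have : star (R * X * E) * (R * X * E) = 0 := by
    rw [← h]; simp only [star_mul, hR.star_eq, mul_assoc]
  have := CStarRing.star_mul_self_eq_zero_iff _ |>.1 this
  rw [mul_assoc R R X, mul_assoc, this, mul_zero]

/-- Every element of the left ideal `𝔄A` lies in `𝔄^A`, since
`(WA)* A (WA) ≤ ‖W* A W‖ A² ≤ ‖W* A W‖ ‖A‖ A`. -/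
lemma mul_mem_aFinite {A : 𝔄} (hA : 0 ≤ A) (W : 𝔄) : W * A ∈ aFinite A := by
  have hsa : IsSelfAdjoint A := .of_nonneg hA
  set M : 𝔄 := star W * A * W with hM
  have hM0 : 0 ≤ M := star_left_conjugate_nonneg hA W
  have h1 : star (W * A) * A * (W * A) ≤ ‖M‖ • (‖A‖ • A) := by
    have e : star (W * A) * A * (W * A) = star A * M * A := by
      rw [hM, star_mul]; simp only [mul_assoc]
    rw [e]
    refine (CStarAlgebra.star_left_conjugate_le_norm_smul (.of_nonneg hM0)).trans ?_
    refine smul_le_smul_of_nonneg_left ?_ (norm_nonneg M)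
    obtain ⟨R, hR, hRA⟩ := exists_isSelfAdjoint_eq_mul_self hA
    have := CStarAlgebra.star_left_conjugate_le_norm_smul (a := R) (b := A) hsa
    rw [hR.star_eq, ← hRA] at this
    refine le_trans (le_of_eq ?_) this
    rw [hsa.star_eq, hRA]; simp only [mul_assoc]
  refine lt_of_le_of_lt (iSup₂_le (a := ENNReal.ofReal √(‖M‖ * ‖A‖)) ?_) ENNReal.ofReal_lt_top
  rintro _ ⟨f, hf, hfA, rfl⟩
  obtain ⟨hpos, hre⟩ := re_apply_pos_and_eq hf.1 hA hfA
  refine ENNReal.ofReal_le_ofReal (Real.sqrt_le_sqrt ?_)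
  rw [smul_apply, hre, ← Complex.ofReal_inv, smul_eq_mul,
    Complex.re_ofReal_mul, inv_mul_le_iff₀ hpos]
  have h2 := (Complex.nonneg_iff.1 (hf.1 _ (sub_nonneg.2 h1))).1
  rw [map_sub, ← Complex.coe_smul, ← Complex.coe_smul, map_smul, map_smul, smul_eq_mul,
    smul_eq_mul, Complex.sub_re, Complex.re_ofReal_mul, Complex.re_ofReal_mul] at h2
  linarith

/-! ### The support projection of a well-supported element -/

/-- The spectral projection of a positive well-supported `A` onto the complement of `0`. The inverse
function is continuous on `σ(A* A)` because `0` is at most an isolated point of it. -/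
lemma WellSupported.exists_support {A : 𝔄} (hA : 0 ≤ A) (h : WellSupported A) :
    ∃ B P : 𝔄, IsStarProjection P ∧ A * P = A ∧ P * A = A ∧ B * A * A = P := by
  have hsa : IsSelfAdjoint A := .of_nonneg hA
  set C : 𝔄 := star A * A with hC
  have hCsa : IsSelfAdjoint C := .star_mul_self A
  have hnorm : IsStarNormal C := hCsa.isStarNormal
  have hcont : ContinuousOn (fun z : ℂ => z⁻¹) (spectrum ℂ C) := by
    intro z hz
    by_cases hz0 : z = 0
    · subst hz0
      have h0 : ContinuousWithinAt (fun z : ℂ => z⁻¹) {0} 0 := continuousWithinAt_singleton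
      refine h0.mono_of_mem_nhdsWithin ?_
      rw [mem_nhdsWithin_iff_eventually]
      filter_upwards [h.isOpen_compl.mem_nhds (x := 0) (by simp)] with w hw hwC
      by_contra hw0
      exact hw ⟨hwC, hw0⟩
    · exact (continuousAt_inv₀ hz0).continuousWithinAt
  set B : 𝔄 := cfc (fun z : ℂ => z⁻¹) C with hB
  have hid : cfc (fun z : ℂ => z) C = C := cfc_id' ℂ C
  have hBC : B * C = cfc (fun z : ℂ => z⁻¹ * z) C := by
    rw [cfc_mul (fun z : ℂ => z⁻¹) (fun z => z) C hcont continuousOn_id, hid]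
  have hCBC : C * (B * C) = C := by
    have e : (fun z : ℂ => z * (z⁻¹ * z)) = fun z => z := by
      ext z
      rw [← mul_assoc]; exact mul_inv_mul_cancel z
    calc C * (B * C) = cfc (fun z : ℂ => z) C * cfc (fun z : ℂ => z⁻¹ * z) C := by rw [hid, hBC]
      _ = cfc (fun z : ℂ => z * (z⁻¹ * z)) C :=
        (cfc_mul (fun z : ℂ => z) (fun z => z⁻¹ * z) C continuousOn_id
          (hcont.mul continuousOn_id)).symm
      _ = C := by rw [e, hid]
  have hPsa : star (B * C) = B * C := by
    rw [hBC, ← cfc_star]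
    congr 1
    ext z
    by_cases hz : z = 0 <;> simp [hz]
  have hPP : B * C * (B * C) = B * C := by rw [mul_assoc, hCBC]
  have hAP : A * (B * C) = A := by
    -- `‖A - AP‖² = ‖(1 - P) C (1 - P)‖ = 0`
    have h0 : star (A - A * (B * C)) * (A - A * (B * C)) = 0 := by
      have e : star (A - A * (B * C)) * (A - A * (B * C)) =
          (1 - star (B * C)) * (C - C * (B * C)) := by
        rw [star_sub, star_mul, hC]; noncomm_ring
      rw [e, hCBC, sub_self, mul_zero]
    exact (sub_eq_zero.1 ((CStarRing.star_mul_self_eq_zero_iff _).1 h0)).symm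
  refine ⟨B, B * C, ⟨hPP, hPsa⟩, hAP, ?_, ?_⟩
  · have := congrArg star hAP
    rwa [star_mul, hPsa, hsa.star_eq] at this
  · rw [hC, hsa.star_eq, mul_assoc]

/-! ### The right and left `A`-spectra -/

/-- A positive `Q` that lives under the support projection `P` of `A` and is not invertible there
(so that `Q + (1 - P)` is not invertible in `𝔄`) is annihilated by a functional in `𝒮_A(𝔄)`. -/
lemma exists_aState_apply_eq_zero {A B P Q : 𝔄} (hA : 0 ≤ A) (hP : IsStarProjection P)
    (hBP : B * A * A = P) (hQ : 0 ≤ Q) (hu : ¬ IsUnit (Q + (1 - P))) :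
    ∃ f ∈ aStates A, (∀ X : 𝔄, 0 ≤ X → 0 ≤ f X) ∧ f A = 1 ∧ f Q = 0 := by
  have h1P : 0 ≤ 1 - P := hP.one_sub.nonneg
  obtain ⟨f, hf, hf1, hf0⟩ := exists_state_apply_eq_zero (add_nonneg hQ h1P) hu
  rw [map_add] at hf0
  obtain ⟨hfQ, hfP⟩ := (add_eq_zero_iff_of_nonneg (hf.1 Q hQ) (hf.1 _ h1P)).1 hf0
  have hfA : f A ≠ 0 := by
    -- If `f(A) = 0`, then `f` vanishes on `𝔄A`, which contains `P`; but `f(P) = f(1) = 1`.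
    intro hfA
    obtain ⟨R, hR, hRA⟩ := exists_isSelfAdjoint_eq_mul_self hA
    have : f (B * A * R * R) = 0 :=
      apply_mul_eq_zero_left hf.1 (by rw [hR.star_eq, ← hRA, hfA]) _
    rw [mul_assoc (B * A), ← hRA, hBP] at this
    rw [map_sub, this, hf1, sub_zero] at hfP
    exact one_ne_zero hfP
  obtain ⟨hpos, hre⟩ := re_apply_pos_and_eq hf.1 hA hfA
  refine ⟨(f A)⁻¹ • f, ⟨f, hf, hfA, rfl⟩, fun X hX => mul_nonneg ?_ (hf.1 X hX), ?_, ?_⟩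
  · rw [hre, ← Complex.ofReal_inv]
    exact_mod_cast inv_nonneg.2 hpos.le
  · simp [hfA]
  · simp [hfQ]

lemma apply_self_of_mem_aStates {A : 𝔄} {f : 𝔄 →L[ℂ] ℂ} (hf : f ∈ aStates A) : f A = 1 := by
  obtain ⟨g, -, hg, rfl⟩ := hf
  simp [hg]

lemma rightASpectrum_eq {A : 𝔄} (hA : 0 ≤ A) (hw : WellSupported A) (X : 𝔄) :
    rightASpectrum A X = {z : ℂ | ∃ f ∈ aStates A,
      (∀ Y ∈ aFinite A, f (A * X * Y) = f (A * X) * f (A * Y)) ∧ z = f (A * X)} := by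
  ext z
  constructor
  · intro hz
    obtain ⟨B, P, hP, hAP, hPA, hBP⟩ := hw.exists_support hA
    set S : 𝔄 := A * (z • (1 : 𝔄) - X) with hS
    have hu : ¬ IsUnit (S * star S + (1 - P)) := by
      rintro ⟨u, hu⟩
      have hPu : S * star S * ↑u⁻¹ = P := by
        have : P * (S * star S + (1 - P)) = S * star S := by
          rw [mul_add, mul_sub, mul_one, hP.isIdempotentElem.eq, sub_self, add_zero, hS,
            ← mul_assoc, ← mul_assoc, hPA]
        rw [← this, ← hu, mul_assoc, u.mul_inv, mul_one]
      refine hz ⟨star S * ↑u⁻¹ * A, mul_mem_aFinite hA _, ?_⟩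
      rw [← hS, ← mul_assoc, ← mul_assoc, hPu, hPA]
    obtain ⟨f, hf, hf0, hfA, hfS⟩ :=
      exists_aState_apply_eq_zero hA hP hBP (mul_star_self_nonneg S) hu
    have h : ∀ Y, f (A * X * Y) = z * f (A * Y) := fun Y => by
      have := apply_mul_eq_zero_right hf0 hfS Y
      rw [hS, mul_sub, sub_mul, map_sub, mul_smul_comm, mul_one, smul_mul_assoc, map_smul,
        smul_eq_mul] at this
      exact (sub_eq_zero.1 this).symm
    have hfX : f (A * X) = z := by simpa [hfA] using h 1
    exact ⟨f, hf, fun Y _ => by rw [h, hfX], hfX.symm⟩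
  · rintro ⟨f, hf, hmul, rfl⟩ ⟨Y, hY, hAY⟩
    have h := congrArg f hAY
    rw [mul_sub, sub_mul, map_sub, hmul Y hY, apply_self_of_mem_aStates hf] at h
    simp at h

lemma leftASpectrum_eq {A : 𝔄} (hA : 0 ≤ A) (hw : WellSupported A) {X : 𝔄}
    (hX : X ∈ aFinite A) :
    leftASpectrum A X = {z : ℂ | ∃ f ∈ aStates A,
      (∀ Y ∈ aFinite A, f (A * Y * X) = f (A * X) * f (A * Y)) ∧ z = f (A * X)} := by
  ext z
  constructor
  · intro hz
    obtain ⟨B, P, hP, hAP, hPA, hBP⟩ := hw.exists_support hA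
    have hker : ∀ Y ∈ aFinite A, A * Y * P = A * Y := fun Y hY => by
      have := mul_mul_eq_zero_of_mem_aFinite hA hY (E := 1 - P)
        (by rw [mul_sub, mul_one, hAP, sub_self])
      rw [mul_sub, mul_one] at this
      exact (sub_eq_zero.1 this).symm
    set S : 𝔄 := A * (z • (1 : 𝔄) - X) with hS
    have hSP : S * P = S := by
      rw [hS, mul_sub, sub_mul, hker X hX, mul_smul_comm, mul_one, smul_mul_assoc, hAP]
    have hu : ¬ IsUnit (star S * S + (1 - P)) := by
      rintro ⟨u, hu⟩
      have hPu : ↑u⁻¹ * (star S * S) = P := by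
        have : (star S * S + (1 - P)) * P = star S * S := by
          rw [add_mul, sub_mul, one_mul, hP.isIdempotentElem.eq, sub_self, add_zero, mul_assoc, hSP]
        rw [← this, ← hu, ← mul_assoc, u.inv_mul, one_mul]
      refine hz ⟨↑u⁻¹ * star S * A, mul_mem_aFinite hA _, ?_⟩
      rw [mul_assoc A, mul_assoc _ A, ← hS, mul_assoc _ _ S, hPu, hAP]
    obtain ⟨f, hf, hf0, hfA, hfS⟩ :=
      exists_aState_apply_eq_zero hA hP hBP (star_mul_self_nonneg S) hu
    have h : ∀ Y, A * Y * P = A * Y → f (A * Y * X) = z * f (A * Y) := fun Y hY => by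
      have := apply_mul_eq_zero_left hf0 hfS (A * Y * B * A)
      -- `AYBA · S = AYP(z - X) = AY(z - X)`
      have e : A * Y * B * A * S = A * Y * (z • (1 : 𝔄) - X) := by
        rw [hS, ← mul_assoc, mul_assoc _ A A, mul_assoc _ B, ← mul_assoc B A A, hBP, hY]
      rw [e, mul_sub, map_sub, mul_smul_comm, mul_one, map_smul, smul_eq_mul] at this
      exact (sub_eq_zero.1 this).symm
    have hfX : f (A * X) = z := by simpa [hfA] using h 1 (by simpa using hAP)
    exact ⟨f, hf, fun Y hY => by rw [h Y (hker Y hY), hfX], hfX.symm⟩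
  · rintro ⟨f, hf, hmul, rfl⟩ ⟨Y, hY, hAY⟩
    have h := congrArg f hAY
    rw [mul_sub, map_sub, hmul Y hY, apply_self_of_mem_aStates hf] at h
    simp at h

end ASpectrum

theorem mainTheorem2 {𝔄 : Type*} [CStarAlgebra 𝔄] [PartialOrder 𝔄] [StarOrderedRing 𝔄] :
    (∀ A : 𝔄, 0 ≤ A → ASpectrum.WellSupported A → ∀ X ∈ ASpectrum.aFinite A,
      ASpectrum.rightASpectrum A X =
        {z : ℂ | ∃ f ∈ ASpectrum.aStates A,
          (∀ Y ∈ ASpectrum.aFinite A, f (A * X * Y) = f (A * X) * f (A * Y)) ∧ z = f (A * X)} ∧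
      ASpectrum.leftASpectrum A X =
        {z : ℂ | ∃ f ∈ ASpectrum.aStates A,
          (∀ Y ∈ ASpectrum.aFinite A, f (A * Y * X) = f (A * X) * f (A * Y)) ∧ z = f (A * X)}) ∧
    (∀ X : 𝔄,
      spectrum ℂ X =
        {z : ℂ | ∃ f ∈ ASpectrum.states 𝔄,
          ((∀ Y : 𝔄, f (X * Y) = f X * f Y) ∨ (∀ Y : 𝔄, f (Y * X) = f X * f Y)) ∧ z = f X}) := by
  exact ⟨fun A hA hw X hX => ⟨ASpectrum.rightASpectrum_eq hA hw X,
    ASpectrum.leftASpectrum_eq hA hw hX⟩, ASpectrum.spectrum_eq_states⟩
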